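/- Setting. A streaming code with source alphabet $\mathcal S$ and channel alphabet $\mathcal X$ consists of encoders $\mathbf x[i]=f_i(\mathbf s[0],\dots,\mathbf s[i])\in\mathcal X$, $i\ge 0$. For a set $E$ of erased times the receiver gets $\mathbf y[i]=\star$ if $i\in E$ and $\mathbf y[i]=\mathbf x[i]$ otherwise. The channel $\mathcal C_I(N,B)$ (for delay $T$) admits exactly those $E\subseteq\{0,1,2,\dots\}$ such that in every window $[t,t+T]$, $t\ge 0$, of length $T+1$, the erased times either form a single burst of at most $B$ consecutive times or are at most $N$ in number, in arbitrary positions. The code is feasible with delay $T$ if there are decoding functions $g_i$ with $\mathbf s[i]=g_i(\mathbf y[0],\dots,\mathbf y[i+T])$ for all $i\ge 0$, all source streams and all admissible $E$. If $\mathcal S=\mathbb F_q^k$ and $\mathcal X=\mathbb F_q^n$, its rate is $R=k/n$. Packets with negative time index are zero. A systematic $(n,k,m)$ convolutional code over $\mathbb F_q$ with sub-generator matrices $[I\;H_0],[0\;H_1],\dots,[0\;H_m]$, $H_t\in\mathbb F_q^{k\times(n-k)}$, maps $\mathbf s[i]$ to $\big(\mathbf s[i],\sum_{t=0}^m\mathbf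 s[i-t]H_t\big)$ (row vectors). It is Strongly-MDS if for each $j=0,\dots,m$ the minimal number of non-zero coordinates of the truncated codeword $(\mathbf x[0],\dots,\mathbf x[j])$ over the source streams with $\mathbf s[0]\ne 0$ equals $(n-k)(j+1)+1$ (nothing is required if $k=0$). Theorem. Let $N,B,T$ be integers with $0\le N\le B\le T$ and $B\ge 1$. Let $\ell=1$ if $\frac{NB}{T+1-N}$ is an integer and $\ell=T+1-N$ otherwise, and let $K=\ell\,\frac{NB}{T+1-N}$. Then there are a finite field $\mathbb F_q$, the matrices $H^v_0,\dots,H^v_T$ of a systematic Strongly-MDS $(\ell T,\ell(T-B),T)$ code and the matrices $H^u_0,\dots,H^u_T$ of a systematic Strongly-MDS $(\ell B+K,\ell B,T)$ code over $\mathbb F_q$, such that the following streaming code (the MiDAS code) is feasible with delay $T$ over $\mathcal C_I(N,B)$. The source packet is $\mathbf s[i]=(\mathbf u[i],\mathbf v[i])$ with $\mathbf u[i]\in\mathbb F_q^{\ell B}$ and $\mathbf v[i]\in\mathbb F_q^{\ell(T-B)}$, and the channel packet is $\mathbf x[i]=(\mathbf u[i],\mathbf v[i],\mathbf q[i],\mathbf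 p_u[i])\in\mathbb F_q^{\ell(T+B)+K}$, where $$\mathbf p_v[i]=\sum_{j=1}^{T}\mathbf v[i-j]H^v_j,\qquad \mathbf q[i]=\mathbf p_v[i]+\mathbf u[i-T],\qquad \mathbf p_u[i]=\sum_{j=1}^{T}\mathbf u[i-j]H^u_j .$$ Its rate $R=\frac{\ell T}{\ell(T+B)+K}$ satisfies $0<R<1$ and $$\frac{R}{1-R}\,B+N\ \ge\ T .$$ -/

import Mathlib

/-! ### Streaming codes over packet erasure channels -/

section Streaming

/-- A causal streaming encoder: the channel packet `x[i] = f_i (s[0], …, s[i])`. -/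
abbrev StreamEncoder (S X : Type*) : Type _ :=
  (i : ℕ) → (Fin (i + 1) → S) → X

/-- The channel packet sent at time `i` when the source stream is `s`. -/
def StreamEncoder.send {S X : Type*} (f : StreamEncoder S X) (s : ℕ → S) (i : ℕ) : X :=
  f i (fun t => s t)

open Classical in
/-- The channel output: `y[i] = ⋆` (that is, `none`) if the time `i` belongs to the set `E` of
erased times, and `y[i] = x[i]` otherwise. -/
noncomputable def channelOutput {X : Type*} (E : Set ℕ) (x : ℕ → X) (i : ℕ) : Option X :=
  if i ∈ E then none else some (x i)

/-- The erasure patterns of the channel `C_I(N, B, W)`: in every window `[t, t + W - 1]` the erased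
times either form a single burst (a set of consecutive times) of length at most `B`, or there are
at most `N` of them, in arbitrary positions. -/
def channelI (N B W : ℕ) : Set (Set ℕ) :=
  {E | ∀ t : ℕ,
    (∃ a b : ℕ, b ≤ B ∧ E ∩ Set.Ico t (t + W) = Set.Ico a (a + b)) ∨
      (E ∩ Set.Ico t (t + W)).ncard ≤ N}

/-- The encoder `f` is feasible with delay `T` on the channel with the set `C` of erasure patterns:
there are decoding functions `s[i] = g_i (y[0], …, y[i + T])` that recover every source packet, for
every source stream and every erasure pattern of the channel. -/
def StreamEncoder.IsFeasible {S X : Type*} (f : StreamEncoder S X) (C : Set (Set ℕ)) (T : ℕ) :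
    Prop :=
  ∃ g : (i : ℕ) → (Fin (i + T + 1) → Option X) → S,
    ∀ E ∈ C, ∀ s : ℕ → S, ∀ i : ℕ,
      g i (fun t => channelOutput E (f.send s) t) = s i

/-- The rate `R = k / n` of a streaming code whose source packets are vectors in `F ^ k` (with `k`
coordinates indexed by `ι`) and whose channel packets are vectors in `F ^ n` (with `n` coordinates
indexed by `κ`), the field `F` being the same. -/
noncomputable def StreamEncoder.rate {F ι κ : Type*} [Fintype ι] [Fintype κ]
    (_f : StreamEncoder (ι → F) (κ → F)) : ℝ :=
  (Fintype.card ι : ℝ) / (Fintype.card κ : ℝ)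

end Streaming

/-! ### Systematic convolutional codes and the Strongly-MDS property -/

section StronglyMDS

variable {F : Type*} [Field F] {k r m : ℕ}

/-- The parity `p[i] = ∑_{t = 0}^{m} s[i - t] H_t` at time `i` of the systematic `(k + r, k, m)`
convolutional code with sub-generator matrices `G_0 = [I H_0]` and `G_t = [0 H_t]` for
`1 ≤ t ≤ m`. Packets with a negative time index are zero. -/
def sysParity (H : Fin (m + 1) → Matrix (Fin k) (Fin r) F) (s : ℕ → Fin k → F) (i : ℕ) :
    Fin r → F :=
  ∑ t : Fin (m + 1), if (t : ℕ) ≤ i then Matrix.vecMul (s (i - t)) (H t) else 0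

/-- The part `∑_{t = 1}^{m} s[i - t] H_t` of the parity at time `i` that comes from the source
packets before time `i`. -/
def pastParity (H : Fin (m + 1) → Matrix (Fin k) (Fin r) F) (s : ℕ → Fin k → F) (i : ℕ) :
    Fin r → F :=
  ∑ t : Fin (m + 1),
    if 1 ≤ (t : ℕ) ∧ (t : ℕ) ≤ i then Matrix.vecMul (s (i - t)) (H t) else 0

/-- The output packet `x[i] = (s[i], p[i])` of the systematic convolutional code. -/
def sysOutput (H : Fin (m + 1) → Matrix (Fin k) (Fin r) F) (s : ℕ → Fin k → F) (i : ℕ) :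
    Fin k ⊕ Fin r → F :=
  Sum.elim (s i) (sysParity H s i)

/-- The `j`-th column distance of the systematic convolutional code: the minimal number of non-zero
coordinates of the truncated codeword `(x[0], …, x[j])` over the source streams with `s[0] ≠ 0`. -/
noncomputable def columnDistance (H : Fin (m + 1) → Matrix (Fin k) (Fin r) F) (j : ℕ) : ℕ :=
  sInf {w | ∃ s : ℕ → Fin k → F, s 0 ≠ 0 ∧
    w = ∑ i ∈ Finset.range (j + 1), {c | sysOutput H s i c ≠ 0}.ncard}

/-- The systematic `(n, k, m)` convolutional code, `n = k + r`, is Strongly-MDS: its `j`-th column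
distance has the largest possible value `(n - k) (j + 1) + 1` for each `j = 0, …, m`. (If `k = 0`
there are no source symbols and nothing is required.) -/
def IsStronglyMDS (H : Fin (m + 1) → Matrix (Fin k) (Fin r) F) : Prop :=
  0 < k → ∀ j ≤ m, columnDistance H j = r * (j + 1) + 1

end StronglyMDS

/-! ### MiDAS codes -/

section MiDAS

/-- The factor by which the packets are expanded: `1` if `N B / (T + 1 - N)` is an integer, and
`T + 1 - N` otherwise. -/
def midasScale (N B T : ℕ) : ℕ :=
  if (T + 1 - N) ∣ N * B then 1 else T + 1 - N

/-- The number `K = ℓ N B / (T + 1 - N)` of coordinates of the parities `p_u`, where `ℓ` is the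
expansion factor (the quotient is an integer if `N ≤ T`). -/
def midasK (N B T : ℕ) : ℕ :=
  midasScale N B T * (N * B) / (T + 1 - N)

/-- The encoder with source packets `s[i] = (u[i], v[i])`, where `u[i]` has `a` and `v[i]` has `b`
coordinates, and channel packets `x[i] = (u[i], v[i], q[i], p_u[i])` with
`p_v[i] = ∑_{j = 1}^{T} v[i - j] Hᵛ_j`, `q[i] = p_v[i] + u[i - T]` and
`p_u[i] = ∑_{j = 1}^{T} u[i - j] Hᵘ_j`. Packets with a negative time index are zero. -/
def midasEncoder {F : Type*} [Field F] {a b K T : ℕ}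
    (Hv : Fin (T + 1) → Matrix (Fin b) (Fin a) F)
    (Hu : Fin (T + 1) → Matrix (Fin a) (Fin K) F) :
    StreamEncoder (Fin a ⊕ Fin b → F) (Fin a ⊕ Fin b ⊕ Fin a ⊕ Fin K → F) :=
  fun i s =>
    let u : ℕ → Fin a → F := fun t c => if h : t < i + 1 then s ⟨t, h⟩ (Sum.inl c) else 0
    let v : ℕ → Fin b → F := fun t c => if h : t < i + 1 then s ⟨t, h⟩ (Sum.inr c) else 0
    let q : Fin a → F := pastParity Hv v i + (if T ≤ i then u (i - T) else 0)
    Sum.elim (u i) (Sum.elim (v i) (Sum.elim q (pastParity Hu u i)))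

end MiDAS

/-! ### Superregular Toeplitz matrices over finite fields -/

/-! Feasibility is a linear question: the difference of two streams with the same received packets
is a stream whose received packets vanish, and it is shown to vanish packet by packet. Each erased
time `i` opens a window `[i, i + T]` of one of two kinds.

In a burst window, `q[t]` equals `p_v[t]` for `t < i + T`, since the interfering packets `u[t - T]`
precede `i`. The Strongly-MDS code of `v` then gives `v = 0` up to time `i + T - 1`, and `q[i + T]`
reduces to `u[i]` (`midas_burst_recovery`). In a window with at most `N` erasures, the code of `u`
gives `u[i] = 0`; this clears the interference in `q` up to `i + T`, and the code of `v` gives `v[i]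
= 0` (`midas_isolated_recovery`). Both use only that a non-zero first packet forces more non-zero
symbols than the erased packets can hold (`IsStronglyMDS.eq_zero_of_received`).

The codes come from one superregular Toeplitz matrix with first row `α ^ d ^ 2`, where `α` avoids
the roots of finitely many non-zero polynomials. A convolution with such a row cannot have too many
zeros (`IsSuperregular.card_zeros_lt`), which gives the column distances. -/

/-- The entry at position `(x, y)` of the upper triangular Toeplitz matrix with first row `φ`. -/
def toeplitzEntry {R : Type*} [Zero R] (φ : ℕ → R) (x y : ℕ) : R :=
  if x ≤ y then φ (y - x) else 0

/-- All minors below `M` of the upper triangular Toeplitz matrix with first row `φ` which have no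
zero on the diagonal are non-zero. -/
def IsSuperregular {R : Type*} [CommRing R] (φ : ℕ → R) (M : ℕ) : Prop :=
  ∀ (n : ℕ) (x y : Fin n → ℕ), StrictMono x → StrictMono y → (∀ l, x l ≤ y l) → (∀ l, y l < M) →
    (Matrix.of fun a b => toeplitzEntry φ (x a) (y b)).det ≠ 0

/-- Expanding the squares leaves `∑ x (σ l) * y l`, and this is the equality case of the
rearrangement inequality. Strictness makes `σ` increasing, hence trivial. -/
theorem perm_eq_one_of_sum_sq_sub_eq {n : ℕ} {x y : Fin n → ℤ} (hx : StrictMono x)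
    (hy : StrictMono y) {σ : Equiv.Perm (Fin n)}
    (h : ∑ l, (y l - x (σ l)) ^ 2 = ∑ l, (y l - x l) ^ 2) : σ = 1 := by
  have hσ : ∑ l, x (σ l) ^ 2 = ∑ l, x l ^ 2 := Equiv.sum_comp σ fun l => x l ^ 2
  have expand : ∀ z : Fin n → ℤ, ∑ l, (y l - z l) ^ 2
      = ∑ l, y l ^ 2 - 2 * ∑ l, z l * y l + ∑ l, z l ^ 2 := by
    intro z
    rw [Finset.mul_sum, ← Finset.sum_sub_distrib, ← Finset.sum_add_distrib]
    exact Finset.sum_congr rfl fun l _ => by ring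
  have h' : ∑ l, x (σ l) * y l = ∑ l, x l * y l := by
    have h1 := expand fun l => x (σ l)
    have h2 := expand x
    beta_reduce at h1
    linarith
  have hmono := ((hx.monotone.monovary hy.monotone).sum_comp_perm_mul_eq_sum_mul_iff).1 h'
  have hσmono : StrictMono σ := by
    refine Monotone.strictMono_of_injective (fun i j hij => ?_) σ.injective
    rcases hij.eq_or_lt with rfl | hlt
    · exact le_rfl
    · exact hx.le_iff_le.1 (hmono (hy hlt))
  have := (hσmono.range_inj strictMono_id).1 (by simp [σ.surjective.range_eq])
  exact Equiv.ext fun i => congrFun this i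

-- In the Leibniz expansion the identity contributes the monomial of degree `∑ (y l - x l) ^ 2`, and
-- no other permutation with a non-zero product has this degree, so its coefficient is 1.
open Polynomial in
theorem isSuperregular_X_pow_sq (R : Type*) [CommRing R] [Nontrivial R] (M : ℕ) :
    IsSuperregular (fun d => (X : R[X]) ^ d ^ 2) M := by
  intro n x y hx hy hxy _ hdet
  have hcoeff := congrArg (fun p => p.coeff (∑ l, (y l - x l) ^ 2)) hdet
  simp only [Matrix.det_apply, finsetSum_coeff, coeff_zero, Polynomial.coeff_smul] at hcoeff
  rw [Finset.sum_eq_single 1] at hcoeff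
  · simp [toeplitzEntry, hxy, Finset.prod_pow_eq_pow_sum] at hcoeff
  · intro σ _ hσ
    by_cases hle : ∀ l, x (σ l) ≤ y l
    · have hne : ∑ l, (y l - x l) ^ 2 ≠ ∑ l, (y l - x (σ l)) ^ 2 := by
        intro heq
        refine hσ (perm_eq_one_of_sum_sq_sub_eq (x := fun l => (x l : ℤ)) (y := fun l => (y l : ℤ))
          (fun i j h => by simpa using hx h) (fun i j h => by simpa using hy h) ?_)
        have hz := congrArg (fun m : ℕ => (m : ℤ)) heq
        push_cast [Nat.cast_sub (hxy _), Nat.cast_sub (hle _)] at hz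
        exact hz.symm
      simp [toeplitzEntry, hle, Finset.prod_pow_eq_pow_sum, coeff_X_pow, hne]
    · push Not at hle
      obtain ⟨l, hl⟩ := hle
      rw [Finset.prod_eq_zero (Finset.mem_univ l) (by simp [toeplitzEntry, hl])]
      simp
  · simp

open Polynomial in
/-- Over some finite field there are Toeplitz matrices of any size that are superregular. -/
theorem exists_isSuperregular_finite_field (M : ℕ) :
    ∃ (F : Type) (_ : Field F) (_ : Finite F) (φ : ℕ → F), IsSuperregular φ M := by
  classical
  let D (n : ℕ) (x y : Fin n → ℕ) : (ZMod 2)[X] :=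
    (Matrix.of fun a b => toeplitzEntry (fun d => (X : (ZMod 2)[X]) ^ d ^ 2) (x a) (y b)).det
  let P : (ZMod 2)[X] := ∏ n ∈ Finset.range (M + 1), ∏ x : Fin n → Fin M, ∏ y : Fin n → Fin M,
    if D n (fun l => x l) (fun l => y l) = 0 then 1 else D n (fun l => x l) (fun l => y l)
  have hP : P ≠ 0 := by
    refine Finset.prod_ne_zero_iff.2 fun n _ => Finset.prod_ne_zero_iff.2 fun x _ =>
      Finset.prod_ne_zero_iff.2 fun y _ => ?_
    split_ifs with h
    · exact one_ne_zero
    · exact h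
  -- A field with more than `P.natDegree` elements contains a non-root of `P`, the product of all
  -- non-zero minors.
  let F := GaloisField 2 (P.natDegree + 1)
  let p : F[X] := P.map (algebraMap (ZMod 2) F)
  have hp : p ≠ 0 := (Polynomial.map_ne_zero_iff (algebraMap (ZMod 2) F).injective).2 hP
  have hcard : (p.natDegree : Cardinal) < Cardinal.mk F := by
    rw [← Nat.cast_card (α := F), GaloisField.card 2 _ (Nat.succ_ne_zero _)]
    refine Nat.cast_lt.2 ?_
    rw [Polynomial.natDegree_map]
    exact (Nat.lt_succ_self _).trans Nat.lt_two_pow_self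
  obtain ⟨α, hα⟩ := p.exists_eval_ne_zero_of_natDegree_lt_card hp hcard
  refine ⟨F, inferInstance, inferInstance, fun d => α ^ d ^ 2, ?_⟩
  intro n x y hx hy hxy hyM hdet
  have hxM : ∀ l, x l < M := fun l => (hxy l).trans_lt (hyM l)
  have hn : n ≤ M := by
    simpa using Fintype.card_le_of_injective (fun l : Fin n => (⟨x l, hxM l⟩ : Fin M))
      (fun a b h => hx.injective (by simpa using h))
  let ψ : (ZMod 2)[X] →+* F := eval₂RingHom (algebraMap (ZMod 2) F) α
  have hψ : ψ (D n x y) = 0 := by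
    rw [← hdet, RingHom.map_det]
    congr 1
    ext a b
    simp only [toeplitzEntry, RingHom.mapMatrix_apply, Matrix.map_apply, Matrix.of_apply]
    split_ifs <;> simp [ψ]
  have hdvd : D n x y ∣ P := by
    have h0 : D n x y ≠ 0 := isSuperregular_X_pow_sq (ZMod 2) M n x y hx hy hxy hyM
    refine dvd_trans ?_ (Finset.dvd_prod_of_mem _ (Finset.mem_range.2 (Nat.lt_succ_of_le hn)))
    refine dvd_trans ?_ (Finset.dvd_prod_of_mem _ (Finset.mem_univ fun l => (⟨x l, hxM l⟩ : Fin M)))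
    refine dvd_trans ?_ (Finset.dvd_prod_of_mem _ (Finset.mem_univ fun l => (⟨y l, hyM l⟩ : Fin M)))
    rw [if_neg h0]
  refine hα ?_
  have : ψ P = 0 := by
    obtain ⟨Q, hQ⟩ := hdvd
    exact (congrArg ψ hQ).trans (by rw [map_mul, hψ, zero_mul])
  rwa [Polynomial.eval_map]

/-- If `φ` is superregular and `a x₀ ≠ 0`, then the convolution of `φ` and `a` has, in each initial
segment, fewer zeros from `x₀` on than `a` has non-zero terms. -/
theorem IsSuperregular.card_zeros_lt {F : Type*} [Field F] [DecidableEq F] {φ : ℕ → F} {M : ℕ}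
    (hφ : IsSuperregular φ M) {a : ℕ → F} {x₀ : ℕ} (hx₀ : a x₀ ≠ 0) {Z : ℕ → Prop}
    [DecidablePred Z]
    (hZ : ∀ z, Z z → x₀ ≤ z ∧ ∑ x ∈ Finset.range (z + 1), a x * φ (z - x) = 0) {N : ℕ}
    (hN : x₀ < N) (hNM : N ≤ M) :
    ((Finset.range N).filter Z).card < ((Finset.range N).filter fun x => a x ≠ 0).card := by
  induction N using Nat.strong_induction_on with
  | _ N ih =>
  let A := (Finset.range N).filter fun x => a x ≠ 0
  let Y := (Finset.range N).filter Z
  by_contra! hle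
  change A.card ≤ Y.card at hle
  let x : Fin A.card ↪o ℕ := A.orderEmbOfFin rfl
  let y : Fin A.card ↪o ℕ := (Fin.castLEOrderEmb hle).trans (Y.orderEmbOfFin rfl)
  have hxA : ∀ l, x l ∈ A := fun l => A.orderEmbOfFin_mem rfl l
  have hyY : ∀ l, y l ∈ Y := fun l => Y.orderEmbOfFin_mem rfl _
  have hyN : ∀ l, y l < N := fun l => Finset.mem_range.1 (Finset.mem_filter.1 (hyY l)).1
  have hyZ : ∀ l, Z (y l) := fun l => (Finset.mem_filter.1 (hyY l)).2
  have hxrange : ∀ z ∈ A, ∃ l, x l = z := fun z hz => by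
    have : z ∈ Set.range x := by rw [Finset.range_orderEmbOfFin]; exact hz
    exact this
  -- Otherwise the segment up to `y l` has at least `l + 1` zeros and at most `l` support points,
  -- against the induction hypothesis.
  have hxy : ∀ l, x l ≤ y l := by
    intro l
    by_contra! hlt
    have hyl : (l : ℕ) + 1 ≤ ((Finset.range (y l + 1)).filter Z).card := by
      have : ((Finset.Iic l).map y.toEmbedding) ⊆ (Finset.range (y l + 1)).filter Z := by
        intro z hz
        simp only [Finset.mem_map, Finset.mem_Iic] at hz
        obtain ⟨l', hl', rfl⟩ := hz
        simp only [Finset.mem_filter, Finset.mem_range]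
        exact ⟨Nat.lt_succ_of_le (y.monotone hl'), hyZ l'⟩
      simpa using Finset.card_le_card this
    have hxl : ((Finset.range (y l + 1)).filter fun x => a x ≠ 0).card ≤ l := by
      have : ((Finset.range (y l + 1)).filter fun x => a x ≠ 0)
          ⊆ (Finset.Iio l).map x.toEmbedding := by
        intro z hz
        simp only [Finset.mem_filter, Finset.mem_range] at hz
        obtain ⟨l', rfl⟩ := hxrange z
          (Finset.mem_filter.2 ⟨Finset.mem_range.2 (by have := hyN l; omega), hz.2⟩)
        simp only [Finset.mem_map, Finset.mem_Iio]
        exact ⟨l', x.lt_iff_lt.1 (by omega), rfl⟩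
      simpa using Finset.card_le_card this
    rcases (show y l + 1 ≤ N from hyN l).eq_or_lt with heq | hlt'
    · have := (Finset.mem_filter.1 (hxA l)).1
      rw [Finset.mem_range] at this
      omega
    · have := ih (y l + 1) hlt' (Nat.lt_succ_of_le (hZ _ (hyZ l)).1) (hlt'.le.trans hNM)
      omega
  have hdet := hφ A.card x y x.strictMono y.strictMono hxy fun l => (hyN l).trans_le hNM
  -- The vanishing convolutions say that `a`, restricted to its support, is in the left kernel of an
  -- invertible minor.
  have hv : (fun l => a (x l)) = 0 := by
    refine Matrix.eq_zero_of_vecMul_eq_zero hdet ?_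
    ext b
    simp only [Matrix.vecMul, dotProduct, Matrix.of_apply, Pi.zero_apply]
    rw [← (hZ _ (hyZ b)).2]
    have h1 : ∑ l, a (x l) * toeplitzEntry φ (x l) (y b)
        = ∑ z ∈ A, a z * toeplitzEntry φ z (y b) := by
      have h2 := Finset.sum_map Finset.univ x.toEmbedding fun z =>
        a z * toeplitzEntry φ z (y b)
      rw [Finset.map_orderEmbOfFin_univ A rfl] at h2
      exact h2.symm
    have h2 : ∑ z ∈ A, a z * toeplitzEntry φ z (y b)
        = ∑ z ∈ Finset.range N, a z * toeplitzEntry φ z (y b) :=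
      Finset.sum_filter_of_ne fun z _ hz => left_ne_zero_of_mul hz
    rw [h1, h2, ← Finset.sum_subset (Finset.range_subset_range.2 (hyN b))]
    · refine Finset.sum_congr rfl fun z hz => ?_
      rw [toeplitzEntry, if_pos (Nat.lt_succ_iff.1 (Finset.mem_range.1 hz))]
    · intro z _ hz
      rw [toeplitzEntry, if_neg (by simpa using hz), mul_zero]
  obtain ⟨l, hl⟩ := hxrange x₀ (Finset.mem_filter.2 ⟨Finset.mem_range.2 hN, hx₀⟩)
  exact hx₀ (hl ▸ congrFun hv l)

/-! ### Strongly-MDS codes from superregular Toeplitz matrices -/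

section ToeplitzCode

variable {F : Type*} [Field F] {k r m : ℕ}

/-- The convolutional code whose sub-generator matrices are blocks of the upper triangular Toeplitz
matrix with first row `φ`, where each packet takes `k + r` consecutive positions: first its source
symbols, then its parity symbols. -/
def toeplitzCode (φ : ℕ → F) (k r m : ℕ) : Fin (m + 1) → Matrix (Fin k) (Fin r) F :=
  fun d => Matrix.of fun c p => φ (d * (k + r) + k + p - c)

/-- The source stream `s` written as one sequence, with `r` zeros after each packet. -/
def serialize (r : ℕ) (s : ℕ → Fin k → F) (x : ℕ) : F :=
  if h : x % (k + r) < k then s (x / (k + r)) ⟨x % (k + r), h⟩ else 0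

theorem serialize_source (s : ℕ → Fin k → F) (t : ℕ) (c : Fin k) :
    serialize r s (t * (k + r) + c) = s t c := by
  have hc : (c : ℕ) < k + r := by omega
  have h1 : (t * (k + r) + c) % (k + r) = c := by
    rw [Nat.mul_add_mod', Nat.mod_eq_of_lt hc]
  have h2 : (t * (k + r) + c) / (k + r) = t := by
    rw [add_comm, Nat.add_mul_div_right _ _ (by omega), Nat.div_eq_of_lt hc, zero_add]
  simp only [serialize, h1, h2, c.isLt, dite_true]

theorem serialize_parity (s : ℕ → Fin k → F) (t p : ℕ) (hp : p < r) :
    serialize r s (t * (k + r) + k + p) = 0 := by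
  have h1 : (t * (k + r) + k + p) % (k + r) = k + p := by
    rw [add_assoc, Nat.mul_add_mod', Nat.mod_eq_of_lt (by omega)]
  simp [serialize, h1]

theorem sum_range_blocks {A : Type*} [AddCommMonoid A] (f : ℕ → A) (k r n : ℕ) :
    ∑ x ∈ Finset.range (n * (k + r)), f x
      = ∑ t ∈ Finset.range n, (∑ c : Fin k, f (t * (k + r) + c)
          + ∑ p : Fin r, f (t * (k + r) + k + p)) := by
  induction n with
  | zero => simp
  | succ n ih =>
    rw [Finset.sum_range_succ, ← ih, add_mul, one_mul, Finset.sum_range_add,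
      Finset.sum_range_add (fun x => f (n * (k + r) + x)),
      Finset.sum_range fun x => f (n * (k + r) + x),
      Finset.sum_range fun x => f (n * (k + r) + (k + x))]
    simp only [add_assoc]

/-- The entries of the sub-generators are `φ` at the distance between a source and a parity
position, so parities are values of a scalar convolution; the parity positions of the serialized
stream are zero and add nothing. -/
theorem sysParity_toeplitzCode (φ : ℕ → F) (s : ℕ → Fin k → F) {i : ℕ} (hi : i ≤ m) (p : Fin r) :
    sysParity (toeplitzCode φ k r m) s i p
      = ∑ x ∈ Finset.range (i * (k + r) + k + p + 1),
          serialize r s x * φ (i * (k + r) + k + p - x) := by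
  have hsub : Finset.range (i * (k + r) + k + p + 1) ⊆ Finset.range ((i + 1) * (k + r)) := by
    refine Finset.range_subset_range.2 ?_
    rw [add_mul]
    omega
  rw [Finset.sum_subset hsub, sum_range_blocks]
  · have hpar : ∀ t, ∑ q : Fin r, serialize r s (t * (k + r) + k + q)
        * φ (i * (k + r) + k + p - (t * (k + r) + k + q)) = 0 := fun t =>
      Finset.sum_eq_zero fun q _ => by rw [serialize_parity s t q q.isLt, zero_mul]
    simp only [hpar, add_zero, serialize_source]
    have hentry : ∀ d : Fin (m + 1),
        (if (d : ℕ) ≤ i then Matrix.vecMul (s (i - d)) (toeplitzCode φ k r m d) else 0) p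
          = if (d : ℕ) ≤ i then ∑ c, s (i - d) c * φ (d * (k + r) + k + p - c) else 0 := by
      intro d
      split_ifs
      · rfl
      · rfl
    rw [← Finset.sum_range_reflect, sysParity, Finset.sum_apply,
      Finset.sum_congr rfl fun d _ => hentry d,
      Fin.sum_univ_eq_sum_range
        (fun d => if d ≤ i then ∑ c, s (i - d) c * φ (d * (k + r) + k + p - c) else 0) (m + 1),
      ← Finset.sum_subset (Finset.range_subset_range.2 (Nat.succ_le_succ hi))]
    · refine Finset.sum_congr rfl fun d hd => ?_
      have hd' : d ≤ i := Nat.lt_succ_iff.1 (Finset.mem_range.1 hd)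
      rw [if_pos hd']
      refine Finset.sum_congr rfl fun c _ => ?_
      obtain ⟨e, rfl⟩ := Nat.exists_eq_add_of_le hd'
      rw [show d + e + 1 - 1 - d = e by omega, show d + e - d = e by omega, add_mul,
        show d * (k + r) + e * (k + r) + k + (p : ℕ) - (e * (k + r) + c)
          = d * (k + r) + k + p - c by omega]
    · intro d _ hd
      rw [if_neg (by simpa using hd)]
  · intro x hx hx'
    simp only [Finset.mem_range, not_lt] at hx hx'
    obtain ⟨q, rfl⟩ := Nat.exists_eq_add_of_le (show i * (k + r) + k ≤ x by omega)
    rw [serialize_parity s i q (by rw [add_mul] at hx; omega), zero_mul]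

theorem sum_ncard_sysOutput [DecidableEq F] (H : Fin (m + 1) → Matrix (Fin k) (Fin r) F)
    (s : ℕ → Fin k → F) (n : ℕ) :
    ∑ i ∈ Finset.range n, {c | sysOutput H s i c ≠ 0}.ncard
        + ∑ i ∈ Finset.range n, ∑ p, (if sysParity H s i p = 0 then 1 else 0)
      = ∑ i ∈ Finset.range n, ∑ c, (if s i c ≠ 0 then 1 else 0) + r * n := by
  have h : ∀ i, {c | sysOutput H s i c ≠ 0}.ncard + ∑ p, (if sysParity H s i p = 0 then 1 else 0)
      = ∑ c, (if s i c ≠ 0 then 1 else 0) + r := by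
    intro i
    have h1 : ∑ p, (if sysParity H s i p ≠ 0 then 1 else 0)
        + ∑ p, (if sysParity H s i p = 0 then 1 else 0) = r := by
      rw [← Finset.sum_add_distrib]
      calc _ = ∑ p : Fin r, 1 := Finset.sum_congr rfl fun p _ => by split_ifs <;> simp_all
        _ = r := by simp
    rw [Set.ncard_eq_toFinset_card', Set.toFinset_ofPred, Finset.card_filter,
      Fintype.sum_sum_type]
    simp only [sysOutput, Sum.elim_inl, Sum.elim_inr]
    rw [add_assoc]
    refine congrArg₂ (· + ·) (by congr!) (Eq.trans ?_ h1)
    congr!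
  rw [← Finset.sum_add_distrib, Finset.sum_congr rfl fun i _ => h i, Finset.sum_add_distrib]
  simp [mul_comm]

/-- Weight is non-zero source symbols plus all `r * (j + 1)` parities minus the zero parities, and
the zero parities are fewer than the non-zero source symbols. -/
theorem isStronglyMDS_toeplitzCode {φ : ℕ → F} {M : ℕ} (hφ : IsSuperregular φ M)
    (hM : (m + 1) * (k + r) ≤ M) : IsStronglyMDS (toeplitzCode φ k r m) := by
  classical
  intro hk j hj
  refine le_antisymm ?_ (le_csInf ?_ ?_)
  · let s : ℕ → Fin k → F := fun t => if t = 0 then Pi.single ⟨0, hk⟩ 1 else 0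
    refine le_trans (Nat.sInf_le ⟨s, ?_, rfl⟩) ?_
    · simp [s]
    · have h := sum_ncard_sysOutput (toeplitzCode φ k r m) s (j + 1)
      have h1 : ∑ i ∈ Finset.range (j + 1), ∑ c, (if s i c ≠ 0 then 1 else 0) = 1 := by
        rw [Finset.sum_range_succ']
        simp [s, Pi.single_apply]
      omega
  · exact ⟨_, fun _ _ => 1, fun h => one_ne_zero (congrFun h ⟨0, hk⟩), rfl⟩
  · rintro w ⟨s, hs, rfl⟩
    have h := sum_ncard_sysOutput (toeplitzCode φ k r m) s (j + 1)
    obtain ⟨c₀, hc₀⟩ := Function.ne_iff.1 hs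
    have hx₀ : serialize r s (c₀ : ℕ) ≠ 0 := by
      have := serialize_source (r := r) s 0 c₀
      rw [zero_mul, zero_add] at this
      rwa [this]
    obtain ⟨Z, hZ⟩ : ∃ Z : ℕ → Prop, ∀ z, Z z ↔ k ≤ z % (k + r) ∧
        ∑ x ∈ Finset.range (z + 1), serialize r s x * φ (z - x) = 0 := ⟨_, fun _ => Iff.rfl⟩
    have hlt := hφ.card_zeros_lt hx₀ (Z := Z)
      (fun z hz => ⟨c₀.isLt.le.trans (((hZ z).1 hz).1.trans (Nat.mod_le _ _)), ((hZ z).1 hz).2⟩)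
      (N := (j + 1) * (k + r)) (by rw [add_mul]; omega)
      ((Nat.mul_le_mul_right _ (by omega)).trans hM)
    rw [Finset.card_filter, Finset.card_filter, sum_range_blocks, sum_range_blocks] at hlt
    have hA : ∀ t, (∑ c : Fin k, if serialize r s (t * (k + r) + c) ≠ 0 then 1 else 0)
        + (∑ p : Fin r, if serialize r s (t * (k + r) + k + p) ≠ 0 then 1 else 0)
        = ∑ c, if s t c ≠ 0 then 1 else 0 := by
      intro t
      simp only [serialize_source, serialize_parity s t _ (Fin.isLt _)]
      simp
    have hpar : ∀ t ∈ Finset.range (j + 1),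
        ∑ p, (if sysParity (toeplitzCode φ k r m) s t p = 0 then 1 else 0)
          ≤ ∑ p : Fin r, if Z (t * (k + r) + k + p) then 1 else 0 := by
      intro t ht
      refine Finset.sum_le_sum fun p _ => ?_
      have hmod : (t * (k + r) + k + p) % (k + r) = k + p := by
        rw [add_assoc, Nat.mul_add_mod', Nat.mod_eq_of_lt (by omega)]
      rw [sysParity_toeplitzCode φ s (by have := Finset.mem_range.1 ht; omega) p]
      simp only [hZ, hmod, Nat.le_add_right, true_and, le_refl]
    have := (Finset.sum_le_sum fun t ht => (hpar t ht).trans (Nat.le_add_left _ _)).trans_lt hlt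
    simp only [hA] at this
    omega

end ToeplitzCode

/-! ### Erasure correction with Strongly-MDS codes -/

section Recovery

variable {F : Type*} [Field F] {k r m : ℕ}

theorem pastParity_sub (H : Fin (m + 1) → Matrix (Fin k) (Fin r) F) (s s' : ℕ → Fin k → F)
    (i : ℕ) : pastParity H (s - s') i = pastParity H s i - pastParity H s' i := by
  rw [pastParity, pastParity, pastParity, ← Finset.sum_sub_distrib]
  refine Finset.sum_congr rfl fun t _ => ?_
  split_ifs
  · rw [Pi.sub_apply, Matrix.sub_vecMul]
  · rw [sub_zero]

theorem pastParity_congr (H : Fin (m + 1) → Matrix (Fin k) (Fin r) F) {s s' : ℕ → Fin k → F}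
    {i : ℕ} (h : ∀ t < i, s t = s' t) : pastParity H s i = pastParity H s' i := by
  refine Finset.sum_congr rfl fun t _ => ?_
  split_ifs with ht
  · rw [h _ (by omega)]
  · rfl

theorem pastParity_eq_zero (H : Fin (m + 1) → Matrix (Fin k) (Fin r) F) {s : ℕ → Fin k → F}
    {i : ℕ} (h : ∀ t < i, s t = 0) : pastParity H s i = 0 := by
  refine Finset.sum_eq_zero fun t _ => ?_
  split_ifs with ht
  · rw [h _ (by omega), Matrix.zero_vecMul]
  · rfl

/-- The two parities differ by the `H 0` term, which acts on the current packet, zero here. -/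
theorem sysParity_shift_eq_pastParity (H : Fin (m + 1) → Matrix (Fin k) (Fin r) F)
    {w : ℕ → Fin k → F} {i t : ℕ} (hw : ∀ t < i, w t = 0) (ht : w (i + t) = 0) :
    sysParity H (fun t => w (i + t)) t = pastParity H w (i + t) := by
  refine Finset.sum_congr rfl fun d _ => ?_
  by_cases hd : (d : ℕ) ≤ t
  · rw [if_pos hd]
    by_cases hd0 : 1 ≤ (d : ℕ)
    · rw [if_pos ⟨hd0, by omega⟩, Nat.add_sub_assoc hd]
    · rw [if_neg (by omega), show t - (d : ℕ) = t by omega]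
      simp only [ht, Matrix.zero_vecMul]
  · rw [if_neg hd]
    split_ifs
    · rw [hw _ (by omega), Matrix.zero_vecMul]
    · rfl

/-- A Strongly-MDS code determines the first packet of a window from the packets received in it if
the number of erased symbols is less than the column distance. -/
theorem IsStronglyMDS.eq_zero_of_received {H : Fin (m + 1) → Matrix (Fin k) (Fin r) F}
    (hH : IsStronglyMDS H) {w : ℕ → Fin k → F} {i j : ℕ} (hj : j ≤ m) (hw : ∀ t < i, w t = 0)
    {E : Set ℕ} (hE : (E ∩ Set.Ico i (i + (j + 1))).ncard * (k + r) ≤ r * (j + 1))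
    (hrec : ∀ t, i ≤ t → t < i + (j + 1) → t ∉ E → w t = 0 ∧ pastParity H w t = 0) : w i = 0 := by
  classical
  by_contra hne
  have hk : 0 < k := by
    obtain ⟨c, _⟩ := Function.ne_iff.1 hne
    exact c.pos
  have hle : columnDistance H j ≤ ∑ t ∈ Finset.range (j + 1),
      {c | sysOutput H (fun t => w (i + t)) t c ≠ 0}.ncard := Nat.sInf_le ⟨_, hne, rfl⟩
  have hcard : ((Finset.range (j + 1)).filter fun t => i + t ∈ E).card
      = (E ∩ Set.Ico i (i + (j + 1))).ncard := by
    rw [← Set.ncard_coe_finset, ← Set.ncard_image_of_injective _ (add_right_injective i)]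
    congr 1
    ext x
    simp only [Finset.coe_filter, Finset.mem_range, Set.mem_image, Set.mem_ofPred_eq,
      Set.mem_inter_iff, Set.mem_Ico]
    constructor
    · rintro ⟨t, ⟨ht, htE⟩, rfl⟩
      exact ⟨htE, by omega, by omega⟩
    · rintro ⟨hxE, hx1, hx2⟩
      obtain ⟨t, rfl⟩ := Nat.exists_eq_add_of_le hx1
      exact ⟨t, ⟨by omega, hxE⟩, rfl⟩
  have hsum : ∑ t ∈ Finset.range (j + 1), {c | sysOutput H (fun t => w (i + t)) t c ≠ 0}.ncard
      ≤ ∑ t ∈ Finset.range (j + 1), if i + t ∈ E then k + r else 0 := by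
    refine Finset.sum_le_sum fun t ht => ?_
    split_ifs with htE
    · refine (Set.ncard_le_card _).trans ?_
      simp
    · obtain ⟨h1, h2⟩ := hrec (i + t) (by omega) (by have := Finset.mem_range.1 ht; omega) htE
      rw [Nat.le_zero, Set.ncard_eq_zero, Set.eq_empty_iff_forall_notMem]
      rintro (c | p) hc
      · exact hc (congrFun h1 c)
      · refine hc ?_
        rw [sysOutput, Sum.elim_inr, sysParity_shift_eq_pastParity H hw h1, h2, Pi.zero_apply]
  rw [← Finset.sum_filter, Finset.sum_const, hcard, smul_eq_mul] at hsum
  have := hH hk j hj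
  omega

end Recovery

/-! ### Feasibility of MiDAS codes -/

section Feasibility

variable {F : Type*} [Field F] {a b K T N B : ℕ}

/-- The channel packet sent at time `i` in terms of the streams `u` and `v`. -/
theorem send_midasEncoder (Hv : Fin (T + 1) → Matrix (Fin b) (Fin a) F)
    (Hu : Fin (T + 1) → Matrix (Fin a) (Fin K) F) (s : ℕ → Fin a ⊕ Fin b → F) (i : ℕ) :
    (midasEncoder Hv Hu).send s i = Sum.elim (fun c => s i (Sum.inl c))
      (Sum.elim (fun c => s i (Sum.inr c))
        (Sum.elim (pastParity Hv (fun t c => s t (Sum.inr c)) i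
            + if T ≤ i then (fun c => s (i - T) (Sum.inl c)) else 0)
          (pastParity Hu (fun t c => s t (Sum.inl c)) i))) := by
  have hu : ∀ t ≤ i, (fun c : Fin a => if h : t < i + 1 then s t (Sum.inl c) else 0)
      = fun c => s t (Sum.inl c) := fun t ht => by
    funext c
    rw [dif_pos (Nat.lt_succ_of_le ht)]
  have hv : ∀ t ≤ i, (fun c : Fin b => if h : t < i + 1 then s t (Sum.inr c) else 0)
      = fun c => s t (Sum.inr c) := fun t ht => by
    funext c
    rw [dif_pos (Nat.lt_succ_of_le ht)]
  simp only [StreamEncoder.send, midasEncoder]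
  rw [hu i le_rfl, hv i le_rfl, hu (i - T) (Nat.sub_le _ _),
    pastParity_congr Hv fun t ht => hv t (le_of_lt ht),
    pastParity_congr Hu fun t ht => hu t (le_of_lt ht)]

theorem eq_of_channelOutput_eq {X : Type*} {E E' : Set ℕ} {x x' : ℕ → X} {t : ℕ} (ht : t ∉ E)
    (h : channelOutput E x t = channelOutput E' x' t) : x t = x' t := by
  rw [channelOutput, channelOutput, if_neg ht] at h
  split_ifs at h
  exact Option.some.inj h

/-- An encoder is feasible if, under each erasure pattern, two source streams with the same channel
output up to time `i + T` agree at time `i`. -/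
theorem StreamEncoder.isFeasible_of_send_eq {S X : Type*} [Nonempty S] {f : StreamEncoder S X}
    {C : Set (Set ℕ)} {T : ℕ}
    (h : ∀ E ∈ C, ∀ s s' : ℕ → S, ∀ i, (∀ t ≤ i + T, t ∉ E → f.send s t = f.send s' t) →
      s i = s' i) : f.IsFeasible C T := by
  classical
  -- The decoder picks any admissible pattern and stream that explain the output.
  refine ⟨fun i y => if hy : ∃ E ∈ C, ∃ s : ℕ → S,
      y = fun t : Fin (i + T + 1) => channelOutput E (f.send s) t
    then hy.choose_spec.2.choose i else Classical.arbitrary S, fun E hE s i => ?_⟩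
  have hy : ∃ E' ∈ C, ∃ s' : ℕ → S, (fun t : Fin (i + T + 1) => channelOutput E (f.send s) t)
    = fun t : Fin (i + T + 1) => channelOutput E' (f.send s') t := ⟨E, hE, s, rfl⟩
  refine (dif_pos hy).trans ?_
  have hspec := hy.choose_spec.2.choose_spec
  refine h E hE _ s i fun t ht htE => ?_
  exact (eq_of_channelOutput_eq htE (congrFun hspec ⟨t, Nat.lt_succ_of_le ht⟩)).symm

/-- Packets that vanish before time `i`, and whose received channel packets in the window
`[i, i + T]` vanish, vanish at time `i`, when the erasures in the window form a burst. -/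
theorem midas_burst_recovery {Hv : Fin (T + 1) → Matrix (Fin b) (Fin a) F}
    (hMv : IsStronglyMDS Hv) (hB : 1 ≤ B) (hBT : B ≤ T) (hab : (b + a) * B = a * T)
    {E : Set ℕ} {u : ℕ → Fin a → F} {v : ℕ → Fin b → F} {i n : ℕ} (hn : n ≤ B)
    (hE : E ∩ Set.Ico i (i + (T + 1)) = Set.Ico i (i + n))
    (hu : ∀ t < i, u t = 0) (hv : ∀ t < i, v t = 0)
    (hrec : ∀ t, i ≤ t → t < i + (T + 1) → t ∉ E →
      v t = 0 ∧ pastParity Hv v t + (if T ≤ t then u (t - T) else 0) = 0) :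
    u i = 0 ∧ v i = 0 := by
  have hnE : ∀ t, i + n ≤ t → t < i + (T + 1) → t ∉ E := by
    intro t h1 h2 htE
    have : t ∈ Set.Ico i (i + n) := hE ▸ ⟨htE, by omega, h2⟩
    exact absurd this.2 (by omega)
  have hvz : ∀ t < i + T, v t = 0 := by
    intro t
    induction t using Nat.strong_induction_on with
    | _ t ih =>
    intro ht
    by_cases hti : t < i
    · exact hv t hti
    by_cases htn : i + n ≤ t
    · exact (hrec t (by omega) (by omega) (hnE t htn (by omega))).1
    obtain ⟨d, rfl⟩ := Nat.exists_eq_add_of_le (not_lt.1 hti)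
    -- The window `[i + d, i + T - 1]` stops just before `u[i]` enters `q`.
    refine hMv.eq_zero_of_received (j := T - 1 - d) (E := E) (by omega)
      (fun t' ht' => ih t' ht' (by omega)) ?_ ?_
    · have hset : E ∩ Set.Ico (i + d) (i + d + (T - 1 - d + 1)) = Set.Ico (i + d) (i + n) := by
        ext t
        have := Set.ext_iff.1 hE t
        simp only [Set.mem_inter_iff, Set.mem_Ico] at this ⊢
        constructor
        · rintro ⟨h1, h2, h3⟩
          exact ⟨h2, (this.1 ⟨h1, by omega, by omega⟩).2⟩
        · rintro ⟨h1, h2⟩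
          exact ⟨(this.2 ⟨by omega, h2⟩).1, h1, by omega⟩
      rw [hset, Set.ncard_Ico_nat, show i + n - (i + d) = n - d by omega,
        show T - 1 - d + 1 = T - d by omega]
      -- After multiplication by `B`, `hab` reduces the claim to `(n - d) * T ≤ (T - d) * B`, which
      -- holds as `n ≤ B ≤ T`.
      refine Nat.le_of_mul_le_mul_right ?_ hB
      rw [mul_assoc, hab, mul_comm (n - d), mul_assoc, mul_assoc]
      refine Nat.mul_le_mul_left _ ?_
      rw [mul_comm T, Nat.sub_mul, Nat.sub_mul]
      have h1 : n * T ≤ T * B := by rw [mul_comm]; exact Nat.mul_le_mul_left _ hn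
      have h2 : d * B ≤ d * T := Nat.mul_le_mul_left _ hBT
      omega
    · intro t h1 h2 htE
      obtain ⟨h3, h4⟩ := hrec t (by omega) (by omega) htE
      refine ⟨h3, ?_⟩
      split_ifs at h4
      · rwa [hu _ (by omega), add_zero] at h4
      · rwa [add_zero] at h4
  have hT := (hrec (i + T) (by omega) (by omega) (hnE _ (by omega) (by omega))).2
  rw [pastParity_eq_zero Hv hvz, zero_add, if_pos (by omega), Nat.add_sub_cancel] at hT
  exact ⟨hT, hvz i (by omega)⟩

/-- Packets that vanish before time `i`, and whose received channel packets in the window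
`[i, i + T]` vanish, vanish at time `i`, when there are few erasures in the window. -/
theorem midas_isolated_recovery {Hv : Fin (T + 1) → Matrix (Fin b) (Fin a) F}
    {Hu : Fin (T + 1) → Matrix (Fin a) (Fin K) F} (hMv : IsStronglyMDS Hv)
    (hMu : IsStronglyMDS Hu) {E : Set ℕ} {u : ℕ → Fin a → F} {v : ℕ → Fin b → F} {i : ℕ}
    (hEu : (E ∩ Set.Ico i (i + (T + 1))).ncard * (a + K) ≤ K * (T + 1))
    (hEv : (E ∩ Set.Ico i (i + (T + 1))).ncard * (b + a) ≤ a * (T + 1))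
    (hu : ∀ t < i, u t = 0) (hv : ∀ t < i, v t = 0)
    (hrec : ∀ t, i ≤ t → t < i + (T + 1) → t ∉ E →
      u t = 0 ∧ v t = 0 ∧ pastParity Hv v t + (if T ≤ t then u (t - T) else 0) = 0 ∧
        pastParity Hu u t = 0) :
    u i = 0 ∧ v i = 0 := by
  have hui : u i = 0 := hMu.eq_zero_of_received le_rfl hu hEu fun t h1 h2 h3 =>
    ⟨(hrec t h1 h2 h3).1, (hrec t h1 h2 h3).2.2.2⟩
  refine ⟨hui, hMv.eq_zero_of_received le_rfl hv hEv fun t h1 h2 h3 => ?_⟩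
  obtain ⟨-, h4, h5, -⟩ := hrec t h1 h2 h3
  refine ⟨h4, ?_⟩
  split_ifs at h5
  · rcases (show t - T ≤ i by omega).eq_or_lt with h6 | h6
    · rwa [h6, hui, add_zero] at h5
    · rwa [hu _ h6, add_zero] at h5
  · rwa [add_zero] at h5

theorem midasEncoder_isFeasible {Hv : Fin (T + 1) → Matrix (Fin b) (Fin a) F}
    {Hu : Fin (T + 1) → Matrix (Fin a) (Fin K) F} (hMv : IsStronglyMDS Hv)
    (hMu : IsStronglyMDS Hu) (hB : 1 ≤ B) (hNB : N ≤ B) (hBT : B ≤ T)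
    (hab : (b + a) * B = a * T) (haK : N * (a + K) ≤ K * (T + 1)) :
    (midasEncoder Hv Hu).IsFeasible (channelI N B (T + 1)) T := by
  refine StreamEncoder.isFeasible_of_send_eq fun E hE s s' I hsend => ?_
  let u : ℕ → Fin a → F := fun t c => s t (Sum.inl c) - s' t (Sum.inl c)
  let v : ℕ → Fin b → F := fun t c => s t (Sum.inr c) - s' t (Sum.inr c)
  have hrec : ∀ t ≤ I + T, t ∉ E → u t = 0 ∧ v t = 0 ∧
      pastParity Hv v t + (if T ≤ t then u (t - T) else 0) = 0 ∧ pastParity Hu u t = 0 := by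
    intro t ht htE
    have h := hsend t ht htE
    rw [send_midasEncoder, send_midasEncoder] at h
    have hq : pastParity Hv v t = pastParity Hv (fun t c => s t (Sum.inr c)) t
      - pastParity Hv (fun t c => s' t (Sum.inr c)) t := pastParity_sub Hv _ _ t
    have hp : pastParity Hu u t = pastParity Hu (fun t c => s t (Sum.inl c)) t
      - pastParity Hu (fun t c => s' t (Sum.inl c)) t := pastParity_sub Hu _ _ t
    refine ⟨funext fun c => sub_eq_zero.2 (congrFun h (Sum.inl c)),
      funext fun c => sub_eq_zero.2 (congrFun h (Sum.inr (Sum.inl c))), funext fun c => ?_,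
      funext fun c => ?_⟩
    · have := congrFun h (Sum.inr (Sum.inr (Sum.inl c)))
      simp only [Sum.elim_inr, Sum.elim_inl, Pi.add_apply] at this
      rw [hq]
      simp only [Pi.add_apply, Pi.sub_apply, Pi.zero_apply]
      split_ifs at this ⊢
      · linear_combination this
      · simp only [Pi.zero_apply] at this ⊢
        linear_combination this
    · have := congrFun h (Sum.inr (Sum.inr (Sum.inr c)))
      rw [hp]
      exact sub_eq_zero.2 this
  have hzero : ∀ i ≤ I, u i = 0 ∧ v i = 0 := by
    intro i
    induction i using Nat.strong_induction_on with
    | _ i ih =>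
    intro hi
    have hu : ∀ t < i, u t = 0 := fun t ht => (ih t ht (by omega)).1
    have hv : ∀ t < i, v t = 0 := fun t ht => (ih t ht (by omega)).2
    by_cases hiE : i ∈ E
    · rcases hE i with ⟨c, n, hn, hEw⟩ | hEw
      · have hic : i ∈ Set.Ico c (c + n) := hEw ▸ ⟨hiE, le_rfl, by omega⟩
        have hci : c ∈ E ∩ Set.Ico i (i + (T + 1)) := by
          rw [hEw]
          exact ⟨le_rfl, hic.1.trans_lt hic.2⟩
        -- The burst contains `i` and lies in a window starting at `i`, so it starts at `i`.
        obtain rfl : i = c := le_antisymm hci.2.1 hic.1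
        exact midas_burst_recovery hMv hB hBT hab hn hEw hu hv fun t _ h2 h3 =>
          ⟨(hrec t (by omega) h3).2.1, (hrec t (by omega) h3).2.2.1⟩
      · refine midas_isolated_recovery hMv hMu ((Nat.mul_le_mul_right _ hEw).trans haK)
          ((Nat.mul_le_mul_right _ (hEw.trans hNB)).trans ?_) hu hv fun t _ h2 h3 =>
            hrec t (by omega) h3
        rw [mul_comm, hab]
        exact Nat.mul_le_mul_left _ (Nat.le_succ _)
    · exact ⟨(hrec i (by omega) hiE).1, (hrec i (by omega) hiE).2.1⟩
  obtain ⟨hu, hv⟩ := hzero I le_rfl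
  funext x
  rcases x with c | c
  · exact sub_eq_zero.1 (congrFun hu c)
  · exact sub_eq_zero.1 (congrFun hv c)

end Feasibility

/-! ### The rate of MiDAS codes -/

theorem midasScale_pos {N B T : ℕ} (hNT : N ≤ T) : 0 < midasScale N B T := by
  unfold midasScale
  split_ifs <;> omega

theorem midasK_mul {N B T : ℕ} :
    midasK N B T * (T + 1 - N) = midasScale N B T * (N * B) := by
  refine Nat.div_mul_cancel ?_
  unfold midasScale
  split_ifs with h
  · rwa [one_mul]
  · exact dvd_mul_right _ _

theorem midasEncoder_rate {F : Type*} [Field F] {a b K T : ℕ}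
    (Hv : Fin (T + 1) → Matrix (Fin b) (Fin a) F) (Hu : Fin (T + 1) → Matrix (Fin a) (Fin K) F) :
    (midasEncoder Hv Hu).rate = ((a : ℝ) + b) / (a + (b + (a + K))) := by
  simp [StreamEncoder.rate]

theorem mainTheorem1 (N B T : ℕ) (hB : 1 ≤ B) (hNB : N ≤ B) (hBT : B ≤ T) :
    ∃ (F : Type) (_ : Field F) (_ : Finite F)
      (Hv : Fin (T + 1) →
        Matrix (Fin (midasScale N B T * (T - B))) (Fin (midasScale N B T * B)) F)
      (Hu : Fin (T + 1) →
        Matrix (Fin (midasScale N B T * B)) (Fin (midasK N B T)) F),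
      IsStronglyMDS Hv ∧ IsStronglyMDS Hu ∧
      (midasEncoder Hv Hu).IsFeasible (channelI N B (T + 1)) T ∧
      0 < (midasEncoder Hv Hu).rate ∧ (midasEncoder Hv Hu).rate < 1 ∧
      (midasEncoder Hv Hu).rate / (1 - (midasEncoder Hv Hu).rate) * (B : ℝ) + (N : ℝ) ≥ (T : ℝ) := by
  have hℓ := midasScale_pos (B := B) (hNB.trans hBT)
  have hK := midasK_mul (N := N) (B := B) (T := T)
  generalize midasScale N B T = ℓ at hℓ hK ⊢
  generalize midasK N B T = K at hK ⊢
  -- With `T = B + D` and `C = T + 1 - N`, truncated subtraction disappears.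
  obtain ⟨D, rfl⟩ := Nat.exists_eq_add_of_le hBT
  obtain ⟨C, hC⟩ := Nat.exists_eq_add_of_le (show N ≤ B + D + 1 by omega)
  rw [hC, Nat.add_sub_cancel_left] at hK
  rw [Nat.add_sub_cancel_left]
  obtain ⟨F, _, _, φ, hφ⟩ := exists_isSuperregular_finite_field
    (max ((B + D + 1) * (ℓ * D + ℓ * B)) ((B + D + 1) * (ℓ * B + K)))
  have hMv := isStronglyMDS_toeplitzCode (m := B + D) hφ (le_max_left _ _)
  have hMu := isStronglyMDS_toeplitzCode (m := B + D) hφ (le_max_right _ _)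
  refine ⟨F, inferInstance, inferInstance, _, _, hMv, hMu,
    midasEncoder_isFeasible hMv hMu hB hNB hBT (by ring) (le_of_eq ?_), ?_⟩
  · rw [hC]
    linear_combination -hK
  rw [midasEncoder_rate]
  have hℓ' : (0 : ℝ) < ℓ := Nat.cast_pos.2 hℓ
  have hB' : (0 : ℝ) < B := Nat.cast_pos.2 hB
  have hC' : (B : ℝ) + D + 1 = N + C := by exact_mod_cast hC
  have hK' : (K : ℝ) * C = ℓ * (N * B) := by exact_mod_cast hK
  have hN0 : (0 : ℝ) ≤ N := Nat.cast_nonneg N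
  have hD0 : (0 : ℝ) ≤ D := Nat.cast_nonneg D
  have hK0 : (0 : ℝ) ≤ K := Nat.cast_nonneg K
  push_cast
  have hp : (0 : ℝ) < ℓ * B := by positivity
  have hden : (0 : ℝ) < ℓ * B + (ℓ * D + (ℓ * B + K)) := by positivity
  refine ⟨by positivity, (div_lt_one hden).2 (by linarith), ?_⟩
  have hR : ((ℓ : ℝ) * B + ℓ * D) / (ℓ * B + (ℓ * D + (ℓ * B + K)))
      / (1 - (ℓ * B + ℓ * D) / (ℓ * B + (ℓ * D + (ℓ * B + K))))
      = (ℓ * B + ℓ * D) / (ℓ * B + K) := by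
    have h1 : (0 : ℝ) < ℓ * B + K := by positivity
    have h2 : 1 - ((ℓ : ℝ) * B + ℓ * D) / (ℓ * B + (ℓ * D + (ℓ * B + K)))
        = (ℓ * B + K) / (ℓ * B + (ℓ * D + (ℓ * B + K))) := by
      field_simp
      ring
    rw [h2, div_div_div_cancel_right₀ hden.ne']
  have hS : (ℓ * B + K : ℝ) * C = ℓ * B * (B + D + 1) := by
    rw [hC']
    linear_combination hK'
  -- By `hS`, `R / (1 - R) * B` is `T * C / (T + 1)`, which exceeds `T - N` by `N / (T + 1)`.
  have hC1 : (B : ℝ) + D - N ≤ (B + D) * C / (B + D + 1) := by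
    rw [le_div_iff₀ (by positivity)]
    nlinarith
  have hX : ((ℓ : ℝ) * B + ℓ * D) / (ℓ * B + K) * B = (B + D) * C / (B + D + 1) := by
    rw [div_mul_eq_mul_div, div_eq_div_iff (by positivity) (by positivity)]
    linear_combination -(B + D : ℝ) * hS
  rw [hR, hX]
  linarith
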